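/- Let $(\mathbb X,f)$ and $(\mathbb Y,g)$ be constructible scalar fields, i.e. up to function-preserving homeomorphism each is obtained from finitely many critical values $a_0<\dots<a_n$, compact locally path-connected critical fibers $V_0,\dots,V_n$ and compact locally path-connected fibers $E_0,\dots,E_{n-1}$, by gluing each cylinder $E_i\times[a_i,a_{i+1}]$ to $V_i\times\{a_i\}$ and $V_{i+1}\times\{a_{i+1}\}$ along continuous attaching maps $E_i\to V_i$ and $E_i\to V_{i+1}$, the function being the projection to $\mathbb R$. (The spaces need not be connected.) Let $\mathcal R_f=(\mathbb X_f,\tilde f)$ and $\mathcal R_g=(\mathbb Y_g,\tilde g)$ be their Reeb graphs: $\mathbb X_f$ is the quotient of $\mathbb X$ that identifies points lying in the same connected component of a level set of $f$, with the induced function $\tilde f$, and similarly for $g$. The interleaving distance $d_I(\mathcal R_f,\mathcal R_g)\in[0,\infty]$ is the infimum of the $\varepsilon\ge 0$ for which the functors $\mathsf F(I)=\pi_0(\tilde f^{-1}(I))$ and $\mathsf G(I)=\pi_0(\tilde g^{-1}(I))$ on open intervals $I=(a,b)$, ordered by inclusion, are $\varepsilon$-interleaved: there are natural maps $\varphi_I:\mathsf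 F(I)\to\mathsf G(I^\varepsilon)$ and $\psi_I:\mathsf G(I)\to\mathsf F(I^\varepsilon)$, where $(a,b)^\varepsilon=(a-\varepsilon,b+\varepsilon)$, such that $\psi_{I^\varepsilon}\circ\varphi_I$ and $\varphi_{I^\varepsilon}\circ\psi_I$ are the maps induced by $I\subseteq I^{2\varepsilon}$. Fix a field $k$ of homology coefficients, and let $\mathrm{Ext}_0(\mathcal R_f)$ be the multiset of points $(a,b)\in\mathbb R^2$ that records the classes of the $0$-dimensional extended persistent homology of $(\mathbb X_f,\tilde f)$ that are born at $a$ in the upward sweep $H_0(\tilde f^{-1}(-\infty,s])$ and die at $b$ in the downward sweep $H_0(\mathbb X_f,\tilde f^{-1}[t,\infty))$. Explicitly, with $r(s,t)=\operatorname{rank}\big(H_0(\tilde f^{-1}(-\infty,s])\to H_0(\mathbb X_f,\tilde f^{-1}[t,\infty))\big)$, the multiplicity of $(a,b)$ is the value, for all small $\delta>0$, of $r(a+\delta,b+\delta)-r(a-\delta,b+\delta)-r(a+\delta,b-\delta)+r(a-\delta,b-\delta)$. For two multisets $D_1,D_2$ of points of the plane, the ungraded bottleneck distance $d_b(D_1,D_2)$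 is the infimum, over all bijections $M$ from a sub-multiset of the off-diagonal points of $D_1$ to a sub-multiset of the off-diagonal points of $D_2$, of the supremum of the numbers $\|x-M(x)\|_\infty$ for matched $x$ and $\tfrac12|x_1-x_2|$ for unmatched points $(x_1,x_2)$ of $D_1$ and $D_2$. Then $$d_b^{\mathrm{Ext}_0}(\mathcal R_f,\mathcal R_g):=d_b\big(\mathrm{Ext}_0(\mathcal R_f),\mathrm{Ext}_0(\mathcal R_g)\big)\le d_I(\mathcal R_f,\mathcal R_g).$$ -/

import Mathlib

open CategoryTheory AlgebraicTopology
open scoped NNReal ENNReal Topology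

universe u

noncomputable section

namespace ReebGraph

/-! ### Constructible scalar fields -/

/-- The gluing data of a constructible scalar field: finitely many critical values
`a 0 < ⋯ < a n`, a compact locally path-connected critical fiber `V i` for each critical value, a
compact locally path-connected fiber `E i` for each interval between consecutive critical values,
and continuous attaching maps from `E i` to the critical fibers below and above it. -/
structure ConstructibleData where
  /-- one less than the number of critical values -/
  n : ℕ
  /-- the critical values -/
  a : Fin (n + 1) → ℝ
  strictMono_a : StrictMono a
  /-- the critical fibers -/
  V : Fin (n + 1) → Type u
  /-- the non-critical fibers -/
  E : Fin n → Type u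
  [topV : ∀ i, TopologicalSpace (V i)]
  [topE : ∀ i, TopologicalSpace (E i)]
  [compactV : ∀ i, CompactSpace (V i)]
  [compactE : ∀ i, CompactSpace (E i)]
  [locV : ∀ i, LocallyPathConnectedSpace (V i)]
  [locE : ∀ i, LocallyPathConnectedSpace (E i)]
  /-- the attaching maps to the critical fiber below -/
  lower : ∀ i : Fin n, C(E i, V i.castSucc)
  /-- the attaching maps to the critical fiber above -/
  upper : ∀ i : Fin n, C(E i, V i.succ)

attribute [instance] ConstructibleData.topV ConstructibleData.topE
  ConstructibleData.compactV ConstructibleData.compactE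
  ConstructibleData.locV ConstructibleData.locE

namespace ConstructibleData

variable (D : ConstructibleData.{u})

/-- The disjoint union of the `V i` (over `a i`) and of the cylinders `E i × [a i, a (i+1)]`. -/
abbrev Pieces : Type u :=
  (Σ i : Fin (D.n + 1), D.V i) ⊕
    (Σ i : Fin D.n, D.E i × Set.Icc (D.a i.castSucc) (D.a i.succ))

lemma a_le (i : Fin D.n) : D.a i.castSucc ≤ D.a i.succ :=
  (D.strictMono_a Fin.castSucc_lt_succ).le

/-- The identifications along the attaching maps. -/
inductive Glue : D.Pieces → D.Pieces → Prop
  | lower (i : Fin D.n) (e : D.E i) :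
      Glue (.inr ⟨i, e, ⟨D.a i.castSucc, Set.left_mem_Icc.2 (D.a_le i)⟩⟩)
        (.inl ⟨i.castSucc, D.lower i e⟩)
  | upper (i : Fin D.n) (e : D.E i) :
      Glue (.inr ⟨i, e, ⟨D.a i.succ, Set.right_mem_Icc.2 (D.a_le i)⟩⟩)
        (.inl ⟨i.succ, D.upper i e⟩)

/-- The glued space, with the quotient topology. -/
def Total : Type u := Quot D.Glue

instance : TopologicalSpace D.Total := inferInstanceAs (TopologicalSpace (Quot D.Glue))

/-- Projection to the real coordinate, on the disjoint union. -/
def preHeight : D.Pieces → ℝ :=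
  Sum.elim (fun p => D.a p.1) (fun p => (p.2.2 : ℝ))

lemma continuous_preHeight : Continuous D.preHeight := by
  refine Continuous.sumElim ?_ ?_
  · exact continuous_sigma fun i => (continuous_const : Continuous fun _ : D.V i => D.a i)
  · exact continuous_sigma fun i => continuous_subtype_val.comp continuous_snd

/-- The function of the glued scalar field: projection to the real coordinate. -/
def height : C(D.Total, ℝ) where
  toFun := Quot.lift D.preHeight (by rintro _ _ (⟨i, e⟩ | ⟨i, e⟩) <;> rfl)
  continuous_toFun := continuous_quot_lift _ D.continuous_preHeight

end ConstructibleData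

/-- A scalar field `(X, f)` is constructible if it is homeomorphic, by a homeomorphism compatible
with the functions, to one built from constructible gluing data. -/
def IsConstructible {X : Type u} [TopologicalSpace X] (f : C(X, ℝ)) : Prop :=
  ∃ (D : ConstructibleData.{u}) (e : X ≃ₜ D.Total), ∀ x, D.height (e x) = f x

/-! ### The Reeb graph -/

section Reeb

variable {X : Type u} [TopologicalSpace X] (f : C(X, ℝ))

/-- `x ∼ y` if `f x = f y` and `x`, `y` lie in the same connected component of that level set. -/
def reebSetoid : Setoid X where
  r x y := f x = f y ∧ y ∈ connectedComponentIn (f ⁻¹' {f x}) x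
  iseqv :=
    { refl := fun x => ⟨rfl, mem_connectedComponentIn rfl⟩
      symm := by
        rintro x y ⟨h, hy⟩
        refine ⟨h.symm, ?_⟩
        rw [← h, ← connectedComponentIn_eq hy]
        exact mem_connectedComponentIn rfl
      trans := by
        rintro x y z ⟨h, hy⟩ ⟨h', hz⟩
        refine ⟨h.trans h', ?_⟩
        rwa [connectedComponentIn_eq hy, h] }

/-- The underlying space of the Reeb graph of `(X, f)`, with the quotient topology. -/
def ReebSpace : Type u := Quotient (reebSetoid f)

instance : TopologicalSpace (ReebSpace f) :=
  inferInstanceAs (TopologicalSpace (Quotient (reebSetoid f)))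

/-- The function induced by `f` on its Reeb graph. -/
def reebMap : C(ReebSpace f, ℝ) where
  toFun := Quotient.lift f fun _ _ h => h.1
  continuous_toFun := f.continuous.quotient_lift _

end Reeb

/-! ### The cosheaf of a scalar field and the interleaving distance -/

/-- Bounded nonempty open intervals `(left, right)` of the real line. -/
@[ext] structure OpenInterval where
  /-- the left endpoint -/
  left : ℝ
  /-- the right endpoint -/
  right : ℝ
  lt : left < right

namespace OpenInterval

/-- The interval as a set of real numbers. -/
def toSet (I : OpenInterval) : Set ℝ := Set.Ioo I.left I.right

/-- Intervals are ordered by inclusion, and form the corresponding category. -/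
instance : Preorder OpenInterval := Preorder.lift toSet

/-- `I = (a, b)` is sent to `(a - ε, b + ε)`. -/
def thicken (ε : ℝ≥0) (I : OpenInterval) : OpenInterval :=
  ⟨I.left - ε, I.right + ε, by have := I.lt; have := ε.2; linarith⟩

lemma le_thicken (ε : ℝ≥0) (I : OpenInterval) : I ≤ I.thicken ε :=
  Set.Ioo_subset_Ioo (sub_le_self _ ε.2) (le_add_of_nonneg_right ε.2)

lemma thicken_mono (ε : ℝ≥0) : Monotone (thicken ε) := by
  intro I J h
  obtain ⟨h₁, h₂⟩ := (Set.Ioo_subset_Ioo_iff I.lt).1 h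
  exact Set.Ioo_subset_Ioo (sub_le_sub_right h₁ _) (by simpa [thicken] using h₂)

end OpenInterval

/-- The map on path components induced by a continuous map. -/
def zerothHomotopyMap {A B : Type u} [TopologicalSpace A] [TopologicalSpace B] (φ : C(A, B)) :
    ZerothHomotopy A → ZerothHomotopy B :=
  ZerothHomotopy.lift (fun a => ZerothHomotopy.mk (φ a))
    fun _ _ p => ZerothHomotopy.sound (p.map φ.continuous)

/-- The cosheaf of `(Z, h)`: it sends an interval `I` to the set of path components of
`h⁻¹(I)`, and inclusions to the maps induced by inclusion. -/
def cosheaf {Z : Type u} [TopologicalSpace Z] (h : C(Z, ℝ)) : OpenInterval ⥤ Type u where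
  obj I := ZerothHomotopy (h ⁻¹' I.toSet)
  map {I J} i := ↾(zerothHomotopyMap
    ⟨Set.inclusion (Set.preimage_mono (leOfHom i)), continuous_inclusion _⟩)
  map_id I := by
    ext x
    induction x using ZerothHomotopy.rec with
    | mk x => rfl
  map_comp i j := by
    ext x
    induction x using ZerothHomotopy.rec with
    | mk x => rfl

/-- The `ε`-smoothing functor on functors from intervals to sets: `(S_ε F)(I) = F(I^ε)`. -/
def smoothing (ε : ℝ≥0) : (OpenInterval ⥤ Type u) ⥤ (OpenInterval ⥤ Type u) :=
  (Functor.whiskeringLeft _ _ _).obj (OpenInterval.thicken_mono ε).functor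

/-- The canonical map `F ⟶ S_ε (S_ε F)`, induced by the inclusions
`I ⊆ (I^ε)^ε = I^(2ε)`. -/
def toSmoothingTwice (ε : ℝ≥0) (F : OpenInterval ⥤ Type u) :
    F ⟶ (smoothing ε).obj ((smoothing ε).obj F) where
  app I := F.map (homOfLE ((I.le_thicken ε).trans ((I.thicken ε).le_thicken ε)))
  naturality I J i := by
    change F.map _ ≫ F.map _ = F.map _ ≫ F.map _
    rw [← F.map_comp, ← F.map_comp]
    rfl

/-- `F` and `G` are `ε`-interleaved. -/
def Interleaved (ε : ℝ≥0) (F G : OpenInterval ⥤ Type u) : Prop :=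
  ∃ (φ : F ⟶ (smoothing ε).obj G) (ψ : G ⟶ (smoothing ε).obj F),
    φ ≫ (smoothing ε).map ψ = toSmoothingTwice ε F ∧
    ψ ≫ (smoothing ε).map φ = toSmoothingTwice ε G

/-- The interleaving distance between two Reeb graphs `(Z, h)` and `(W, h')`; it is `∞` if there
is no interleaving. -/
def interleavingDist {Z W : Type u} [TopologicalSpace Z] [TopologicalSpace W]
    (h : C(Z, ℝ)) (h' : C(W, ℝ)) : ℝ≥0∞ :=
  ⨅ (ε : ℝ≥0) (_ : Interleaved ε (cosheaf h) (cosheaf h')), (ε : ℝ≥0∞)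

/-! ### Extended persistence -/

section Persistence

variable (k : Type u) [Field k] (d : ℕ) {Z : Type u} [TopologicalSpace Z] (h : C(Z, ℝ))

/-- The singular chain complex with coefficients in `k`. -/
abbrev chains : TopCat.{u} ⥤ ChainComplex (ModuleCat.{u} k) ℕ :=
  (singularChainComplexFunctor (ModuleCat.{u} k)).obj (ModuleCat.of k k)

/-- The inclusion of a subset, as a morphism of topological spaces. -/
def incl (A : Set Z) : TopCat.of A ⟶ TopCat.of Z :=
  TopCat.ofHom ⟨Subtype.val, continuous_subtype_val⟩

/-- The relative singular chain complex `C(Z, A) = C(Z) / C(A)`. -/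
def relChains (A : Set Z) : ChainComplex (ModuleCat.{u} k) ℕ :=
  Limits.cokernel ((chains k).map (incl A))

/-- The map `H_d(A) ⟶ H_d(Z) ⟶ H_d(Z, B)` for subsets `A` and `B` of `Z`. -/
def homologyToRel (A B : Set Z) :
    ((chains k).obj (TopCat.of A)).homology d ⟶ (relChains k B).homology d :=
  HomologicalComplex.homologyMap ((chains k).map (incl A)) d ≫
    HomologicalComplex.homologyMap (Limits.cokernel.π ((chains k).map (incl B))) d

/-- The extended persistent Betti number: the rank of
`H_d(Z_{≤ s}) ⟶ H_d(Z) ⟶ H_d(Z, Z_{≥ t})`, from the upward sweep at the value `s` to the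
downward sweep at the value `t`. -/
def extBetti (s t : ℝ) : ℕ :=
  Module.finrank k
    (LinearMap.range (homologyToRel k d (h ⁻¹' Set.Iic s) (h ⁻¹' Set.Ici t)).hom)

/-- The number of classes that are born in the upward sweep between the values `a - δ` and
`a + δ` and die in the downward sweep between the values `b + δ` and `b - δ`. -/
def extCount (a b δ : ℝ) : ℤ :=
  ((extBetti k d h (a + δ) (b + δ) : ℤ) - extBetti k d h (a - δ) (b + δ)) -
    (extBetti k d h (a + δ) (b - δ) - extBetti k d h (a - δ) (b - δ))

end Persistence

/-- A persistence diagram, as a multiset of points of the plane given by multiplicities. -/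
abbrev Diagram : Type := ℝ × ℝ → ℕ

/-- The subdiagram `Ext_d` of the extended persistence diagram of `(Z, h)`: the multiplicity of
`(a, b)` is the number of classes born at `a` in the upward sweep and dying at `b` in the downward
sweep, that is, the value of `extCount` for all small `δ > 0`. -/
def extDiagram (k : Type u) [Field k] (d : ℕ) {Z : Type u} [TopologicalSpace Z] (h : C(Z, ℝ)) :
    Diagram :=
  fun p => sInf {m : ℕ | ∀ᶠ δ in 𝓝[>] (0 : ℝ), extCount k d h p.1 p.2 δ = m}

/-! ### The bottleneck distance -/

namespace Diagram

/-- The points of a diagram, repeated according to their multiplicity. -/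
def Points (D : Diagram) : Type := Σ p : ℝ × ℝ, Fin (D p)

/-- Half of `|x₁ - x₂|`, the sup-norm distance from `(x₁, x₂)` to the diagonal. -/
def diagCost (p : ℝ × ℝ) : ℝ≥0∞ := ENNReal.ofReal (|p.1 - p.2| / 2)

/-- A matching is a bijection between a subset of the off-diagonal points of `D₁` and a subset of
the off-diagonal points of `D₂`. -/
structure Matching (D₁ D₂ : Diagram) where
  /-- the partial bijection -/
  toPEquiv : D₁.Points ≃. D₂.Points
  offDiag : ∀ x y, toPEquiv x = some y → x.1.1 ≠ x.1.2 ∧ y.1.1 ≠ y.1.2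

/-- The cost of a matching. Distances in `ℝ × ℝ` are taken in the sup norm. -/
def Matching.cost {D₁ D₂ : Diagram} (M : Matching D₁ D₂) : ℝ≥0∞ :=
  (⨆ (x : D₁.Points) (y : D₂.Points) (_ : M.toPEquiv x = some y), edist x.1 y.1) ⊔
    (⨆ (x : D₁.Points) (_ : M.toPEquiv x = none), diagCost x.1) ⊔
    (⨆ (y : D₂.Points) (_ : M.toPEquiv.symm y = none), diagCost y.1)

/-- The (ungraded) bottleneck distance. -/
def bottleneckDist (D₁ D₂ : Diagram) : ℝ≥0∞ := ⨅ M : Matching D₁ D₂, M.cost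

end Diagram

/-- The ungraded bottleneck distance between the `Ext_d` subdiagrams of two Reeb graphs. -/
def extBottleneckDist (k : Type u) [Field k] (d : ℕ) {Z W : Type u} [TopologicalSpace Z]
    [TopologicalSpace W] (h : C(Z, ℝ)) (h' : C(W, ℝ)) : ℝ≥0∞ :=
  Diagram.bottleneckDist (extDiagram k d h) (extDiagram k d h')

end ReebGraph

end

/-!
In degree zero, extended persistence only sees the path components of the whole space. Let `Z` be
compact and locally path-connected, as every Reeb graph of a constructible scalar field is. Then `Z`
has finitely many path components, each of them compact. The module `H₀(Z, Z_{≥ t})` is free on the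
components that miss `Z_{≥ t}`, and the image of `H₀(Z_{≤ s})` in it is spanned by those among them
that meet `Z_{≤ s}` (`extBetti_zero_eq_card`). Hence `Ext₀` consists of the points
`(min_C h, max_C h)`, one for each path component `C` (`extDiagram_zero`).

The cosheaf of `Z` takes the value `π₀(Z)` on large intervals, so an `ε`-interleaving induces a
bijection `Φ` between the path components of the two spaces. Applied to small intervals around the
minimum and the maximum of `h` on a component `C`, the interleaving maps yield points of `Φ C` whose
heights differ from these extreme values by little more than `ε`. With the same bound for the
inverse bijection, `Φ` moves the points of `Ext₀` by at most `ε` in the sup norm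
(`Interleaved.exists_equiv`), and the matching that it defines has cost at most `ε`
(`Diagram.bottleneckDist_le_of_equiv`).
-/

namespace ReebGraph

/-! ### Linear algebra of free modules on sets -/

/-- A linear map that corresponds to `k[l]` under isomorphisms with free modules has the span of
`range l` as its image. -/
lemma range_comp_of_comp_eq_lmapDomain {k : Type*} [Field k] {δ γ W V : Type*}
    [AddCommGroup W] [Module k W] [AddCommGroup V] [Module k V] (l : δ → γ)
    (eW : W ≃ₗ[k] (δ →₀ k)) (e : V ≃ₗ[k] (γ →₀ k)) (i : W →ₗ[k] V)
    (h : e.toLinearMap ∘ₗ i = Finsupp.lmapDomain k k l ∘ₗ eW.toLinearMap) :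
    LinearMap.range (e.toLinearMap ∘ₗ i) = Finsupp.supported k k (Set.range l) := by
  rw [h, LinearMap.range_comp, LinearEquiv.range, ← Finsupp.supported_univ,
    Finsupp.lmapDomain_supported, Set.image_univ]

/-- If `q` has kernel `k[range g]` in `k[γ]`, then the image under `q` of `k[range f]` is free on
`range f \ range g`. The free modules enter only up to isomorphism. If the difference is infinite,
both sides are `0` by convention. -/
lemma finrank_range_comp_of_finsupp {k : Type*} [Field k] {α β γ VA VB V Q : Type*}
    [AddCommGroup VA] [Module k VA] [AddCommGroup VB] [Module k VB]
    [AddCommGroup V] [Module k V] [AddCommGroup Q] [Module k Q]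
    (f : α → γ) (g : β → γ)
    (eA : VA ≃ₗ[k] (α →₀ k)) (eB : VB ≃ₗ[k] (β →₀ k)) (e : V ≃ₗ[k] (γ →₀ k))
    (iA : VA →ₗ[k] V) (iB : VB →ₗ[k] V) (q : V →ₗ[k] Q)
    (hA : e.toLinearMap ∘ₗ iA = Finsupp.lmapDomain k k f ∘ₗ eA.toLinearMap)
    (hB : e.toLinearMap ∘ₗ iB = Finsupp.lmapDomain k k g ∘ₗ eB.toLinearMap)
    (hq : LinearMap.ker q = LinearMap.range iB) :
    Module.finrank k (LinearMap.range (q ∘ₗ iA)) =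
      Nat.card {c : γ // c ∈ Set.range f ∧ c ∉ Set.range g} := by
  -- Restriction to the complement of `range g` is a model of `q`: it has the same kernel.
  let ρ : (γ →₀ k) →ₗ[k] ((Set.range g)ᶜ : Set γ) →₀ k :=
    Finsupp.lsubtypeDomain (Set.range g)ᶜ
  have hker : LinearMap.ker (ρ ∘ₗ e.toLinearMap) = LinearMap.ker q := by
    have h1 : LinearMap.ker ρ = Finsupp.supported k k (Set.range g) := by
      ext p
      rw [LinearMap.mem_ker, Finsupp.mem_supported', Finsupp.ext_iff]
      exact Subtype.forall
    rw [LinearMap.ker_comp, h1, ← range_comp_of_comp_eq_lmapDomain g eB e iB hB,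
      LinearMap.range_comp, Submodule.comap_map_eq_of_injective e.injective, hq]
  have hker' : LinearMap.ker (q ∘ₗ iA) = LinearMap.ker (ρ ∘ₗ (e.toLinearMap ∘ₗ iA)) := by
    rw [← LinearMap.comp_assoc, LinearMap.ker_comp, LinearMap.ker_comp, hker]
  have hfin : LinearMap.range (ρ ∘ₗ (e.toLinearMap ∘ₗ iA)) =
      Finsupp.supported k k {c : ((Set.range g)ᶜ : Set γ) | c.1 ∈ Set.range f} := by
    rw [LinearMap.range_comp, range_comp_of_comp_eq_lmapDomain f eA e iA hA]
    ext p
    simp only [Submodule.mem_map, Finsupp.mem_supported']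
    constructor
    · rintro ⟨p, hp, rfl⟩ c hc
      exact hp _ hc
    · intro hp
      refine ⟨p.mapDomain Subtype.val, fun c hc => ?_, ?_⟩
      · by_cases hcg : c ∈ (Set.range g)ᶜ
        · rw [← hp ⟨c, hcg⟩ hc]
          exact Finsupp.mapDomain_apply Subtype.val_injective p ⟨c, hcg⟩
        · exact Finsupp.mapDomain_of_notMem_range _ _ (by simpa using hcg)
      · ext c
        exact Finsupp.mapDomain_apply Subtype.val_injective p c
  rw [((LinearMap.quotKerEquivRange _).symm.trans
      ((Submodule.quotEquivOfEq _ _ hker').trans (LinearMap.quotKerEquivRange _))).finrank_eq,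
    hfin, Module.finrank_eq_nat_card_basis
      ((Finsupp.basisSingleOne (R := k)).map (Finsupp.supportedEquivFinsupp _).symm)]
  exact Nat.card_congr ((Equiv.subtypeSubtypeEquivSubtypeInter
    (fun c => c ∈ (Set.range g)ᶜ) (fun c => c ∈ Set.range f)).trans
    (Equiv.subtypeEquivRight fun c => and_comm))

/-! ### Homology in degree zero -/

section Homology

variable (k : Type u) [Field k]

open Limits Simplicial

/-- The coproduct of copies of `k` indexed by `S` is the free module on `S`. -/
noncomputable def sigmaConstIsoFree (S : Type u) :
    (∐ fun _ : S => ModuleCat.of k k) ≅ ModuleCat.of k (S →₀ k) where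
  hom := Sigma.desc fun s => ModuleCat.ofHom (Finsupp.lsingle s)
  inv := ModuleCat.ofHom (Finsupp.lsum k fun s => (Sigma.ι (fun _ : S => ModuleCat.of k k) s).hom)
  hom_inv_id := by
    refine Sigma.hom_ext _ _ fun s => ?_
    rw [Sigma.ι_desc_assoc]
    ext
    simp
  inv_hom_id := by
    ext s : 2
    apply LinearMap.ext_ring
    simp [← ConcreteCategory.comp_apply]

/-- The zeroth singular homology of a space is the free module on its path components. -/
noncomputable def homologyZeroEquiv (Z : TopCat.{u}) :
    ((chains k).obj Z).homology 0 ≃ₗ[k] (ZerothHomotopy Z →₀ k) :=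
  ((TopCat.singularHomology₀Iso Z (ModuleCat.of k k)).trans
    (sigmaConstIsoFree k (ZerothHomotopy Z))).toLinearEquiv

/-- The class of a vertex in the homology of a simplicial set, as a morphism from the ring of
coefficients. -/
noncomputable def vertexClass (S : SSet.{u}) (x : S _⦋0⦌) :
    ModuleCat.of k k ⟶ S.homology (ModuleCat.of k k) 0 :=
  (S.chainComplex (ModuleCat.of k k)).liftCycles (S.ιChainComplex x) 0 (by simp) (by simp) ≫
    (S.chainComplex (ModuleCat.of k k)).homologyπ 0

lemma vertexClass_homologyMap {S T : SSet.{u}} (φ : S ⟶ T) (x : S _⦋0⦌) :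
    vertexClass k S x ≫ SSet.homologyMap φ (ModuleCat.of k k) 0 =
      vertexClass k T (φ.app _ x) := by
  simp [vertexClass, SSet.homologyMap]

/-- The class of a point in the singular homology of a space. -/
noncomputable def pointClass (Z : TopCat.{u}) (z : Z) : ((chains k).obj Z).homology 0 :=
  (vertexClass k (TopCat.toSSet.obj Z) (TopCat.toSSetObj₀Equiv.symm z)).hom (1 : k)

lemma homologyMap_pointClass {A Z : TopCat.{u}} (φ : A ⟶ Z) (x : A) :
    (HomologicalComplex.homologyMap ((chains k).map φ) 0).hom (pointClass k A x) =
      pointClass k Z (φ x) :=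
  congr($(vertexClass_homologyMap k (TopCat.toSSet.map φ) (TopCat.toSSetObj₀Equiv.symm x)).hom
    (1 : k))

lemma homologyZeroEquiv_pointClass (Z : TopCat.{u}) (z : Z) :
    homologyZeroEquiv k Z (pointClass k Z z) = Finsupp.single (ZerothHomotopy.mk z) 1 := by
  have h1 := SSet.liftCycles_ιChainComplex_homologyπ_homology₀Iso_hom_assoc
    (TopCat.toSSet.obj Z) (ModuleCat.of k k) (TopCat.toSSetObj₀Equiv.symm z)
    ((sigmaConst.obj (ModuleCat.of k k)).map (↾(TopCat.zerothHomotopyEquiv (X := Z)).symm) ≫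
      (sigmaConstIsoFree k (ZerothHomotopy Z)).hom)
  have h2 : vertexClass k (TopCat.toSSet.obj Z) (TopCat.toSSetObj₀Equiv.symm z) ≫
      ((TopCat.toSSet.obj Z).homology₀Iso (ModuleCat.of k k)).hom ≫
      (sigmaConst.obj (ModuleCat.of k k)).map (↾(TopCat.zerothHomotopyEquiv (X := Z)).symm) ≫
      (sigmaConstIsoFree k (ZerothHomotopy Z)).hom =
      ModuleCat.ofHom (Finsupp.lsingle (ZerothHomotopy.mk z)) := by
    rw [vertexClass, Category.assoc]
    refine h1.trans ?_
    simp [sigmaConstIsoFree]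
  exact congr($(h2).hom (1 : k))

/-- The classes of points generate homology in degree zero. -/
lemma homologyZero_hom_ext {Z : TopCat.{u}} {M : Type*} [AddCommGroup M] [Module k M]
    {φ ψ : ((chains k).obj Z).homology 0 →ₗ[k] M}
    (h : ∀ z, φ (pointClass k Z z) = ψ (pointClass k Z z)) : φ = ψ := by
  suffices φ ∘ₗ (homologyZeroEquiv k Z).symm.toLinearMap =
      ψ ∘ₗ (homologyZeroEquiv k Z).symm.toLinearMap by
    refine LinearMap.ext fun x => ?_
    simpa using congr($this (homologyZeroEquiv k Z x))
  refine Finsupp.lhom_ext' fun C => LinearMap.ext_ring ?_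
  induction C with
  | mk z => simpa [← homologyZeroEquiv_pointClass] using h z

lemma homologyZeroEquiv_naturality {A Z : TopCat.{u}} (φ : A ⟶ Z) :
    (homologyZeroEquiv k Z).toLinearMap ∘ₗ
        (HomologicalComplex.homologyMap ((chains k).map φ) 0).hom =
      Finsupp.lmapDomain k k (zerothHomotopyMap φ.hom) ∘ₗ
        (homologyZeroEquiv k A).toLinearMap := by
  refine homologyZero_hom_ext k fun x => ?_
  trans Finsupp.single (ZerothHomotopy.mk (φ x)) 1
  · rw [← homologyZeroEquiv_pointClass, ← homologyMap_pointClass]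
    rfl
  · refine Eq.symm ((congrArg (Finsupp.lmapDomain k k (zerothHomotopyMap φ.hom))
      (homologyZeroEquiv_pointClass k A x)).trans ?_)
    exact Finsupp.mapDomain_single

/-- Exactness of the homology sequence of the pair `(Z, B)` at the homology of `Z`. -/
lemma ker_homologyMap_relChains {Z : Type u} [TopologicalSpace Z] (B : Set Z) (d : ℕ) :
    LinearMap.ker (HomologicalComplex.homologyMap
        (cokernel.π ((chains k).map (incl B))) d).hom =
      LinearMap.range (HomologicalComplex.homologyMap ((chains k).map (incl B)) d).hom := by
  have : Mono (incl B) := (TopCat.mono_iff_injective _).2 Subtype.val_injective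
  have hS : (ShortComplex.mk ((chains k).map (incl B)) (cokernel.π ((chains k).map (incl B)))
      (cokernel.condition _)).ShortExact :=
    { exact := ShortComplex.exact_of_g_is_cokernel _ (cokernelIsCokernel _)
      mono_f := inferInstance
      epi_g := inferInstance }
  exact ((ShortComplex.moduleCat_exact_iff_range_eq_ker _).1 (hS.homology_exact₂ d)).symm

/-- In degree zero, the extended Betti number counts the path components that meet the sublevel
set and miss the superlevel set. -/
lemma extBetti_zero_eq_card {Z : Type u} [TopologicalSpace Z] (h : C(Z, ℝ)) (s t : ℝ) :
    extBetti k 0 h s t =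
      Nat.card {C : ZerothHomotopy Z // (∃ z, ZerothHomotopy.mk z = C ∧ h z ≤ s) ∧
        ∀ z, ZerothHomotopy.mk z = C → h z < t} := by
  have hmem (S : Set ℝ) (C : ZerothHomotopy Z) :
      C ∈ Set.range (zerothHomotopyMap (incl (h ⁻¹' S)).hom) ↔
        ∃ z, ZerothHomotopy.mk z = C ∧ h z ∈ S := by
    constructor
    · rintro ⟨x, rfl⟩
      induction x with
      | mk x => exact ⟨x.1, rfl, x.2⟩
    · rintro ⟨z, rfl, hz⟩
      exact ⟨ZerothHomotopy.mk ⟨z, hz⟩, rfl⟩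
  refine (finrank_range_comp_of_finsupp _ _ (homologyZeroEquiv k _) (homologyZeroEquiv k _)
    (homologyZeroEquiv k _) _ _ _ (homologyZeroEquiv_naturality k (incl (h ⁻¹' Set.Iic s)))
    (homologyZeroEquiv_naturality k (incl (h ⁻¹' Set.Ici t)))
    (ker_homologyMap_relChains k _ 0)).trans ?_
  refine Nat.card_congr (Equiv.subtypeEquivRight fun C => and_congr (hmem _ C) ?_)
  rw [hmem]
  simp

end Homology

/-! ### Extreme values on path components -/

section Extremes

variable {Z : Type u} [TopologicalSpace Z] (h : C(Z, ℝ))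

/-- The smallest value of `h` on a path component (the minimum is attained when `Z` is compact and
locally path-connected, see `isLeast_minOn`). -/
noncomputable def minOn (C : ZerothHomotopy Z) : ℝ := sInf (h '' (ZerothHomotopy.mk ⁻¹' {C}))

/-- The largest value of `h` on a path component (the maximum is attained when `Z` is compact and
locally path-connected, see `isGreatest_maxOn`). -/
noncomputable def maxOn (C : ZerothHomotopy Z) : ℝ := sSup (h '' (ZerothHomotopy.mk ⁻¹' {C}))

variable [CompactSpace Z] [LocallyPathConnectedSpace Z]

lemma isCompact_fiber_mk (C : ZerothHomotopy Z) :
    IsCompact (ZerothHomotopy.mk ⁻¹' {C} : Set Z) :=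
  ((isClosed_discrete {C}).preimage ZerothHomotopy.isQuotientMap_mk.continuous).isCompact

lemma isLeast_minOn (C : ZerothHomotopy Z) :
    IsLeast (h '' (ZerothHomotopy.mk ⁻¹' {C})) (minOn h C) :=
  ((isCompact_fiber_mk C).image h.continuous).isLeast_sInf
    ((Set.singleton_nonempty C).preimage ZerothHomotopy.mk_surjective |>.image h)

lemma isGreatest_maxOn (C : ZerothHomotopy Z) :
    IsGreatest (h '' (ZerothHomotopy.mk ⁻¹' {C})) (maxOn h C) :=
  ((isCompact_fiber_mk C).image h.continuous).isGreatest_sSup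
    ((Set.singleton_nonempty C).preimage ZerothHomotopy.mk_surjective |>.image h)

lemma minOn_mk_le (z : Z) : minOn h (.mk z) ≤ h z := (isLeast_minOn h _).2 ⟨z, rfl, rfl⟩

lemma le_maxOn_mk (z : Z) : h z ≤ maxOn h (.mk z) := (isGreatest_maxOn h _).2 ⟨z, rfl, rfl⟩

lemma exists_eq_minOn (C : ZerothHomotopy Z) : ∃ z, ZerothHomotopy.mk z = C ∧ h z = minOn h C :=
  (isLeast_minOn h C).1

lemma exists_eq_maxOn (C : ZerothHomotopy Z) : ∃ z, ZerothHomotopy.mk z = C ∧ h z = maxOn h C :=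
  (isGreatest_maxOn h C).1

/-! ### The diagram in degree zero -/

variable (k : Type u) [Field k]

open Classical in
lemma extBetti_zero_eq_sum [Fintype (ZerothHomotopy Z)] (s t : ℝ) :
    (extBetti k 0 h s t : ℤ) =
      ∑ C : ZerothHomotopy Z, if minOn h C ≤ s ∧ maxOn h C < t then 1 else 0 := by
  rw [extBetti_zero_eq_card, Finset.sum_boole, Nat.card_eq_fintype_card, Fintype.card_subtype]
  congr 2
  refine Finset.filter_congr fun C _ => and_congr ⟨?_, fun hC => ?_⟩ ⟨fun hC => ?_, ?_⟩
  · rintro ⟨z, rfl, hz⟩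
    exact (minOn_mk_le h z).trans hz
  · obtain ⟨z, rfl, hz⟩ := exists_eq_minOn h C
    exact ⟨z, rfl, hz.trans_le hC⟩
  · obtain ⟨z, rfl, hz⟩ := exists_eq_maxOn h C
    exact hz ▸ hC z rfl
  · rintro hC z rfl
    exact (le_maxOn_mk h z).trans_lt hC

/-- The inclusion–exclusion over the four quadrants with corners `(a ± δ, b ± δ)` isolates the
point `(a, b)` for small `δ`. -/
lemma eventually_quadrant_count (a b x y : ℝ) :
    ∀ᶠ δ in 𝓝[>] (0 : ℝ),
      (((if x ≤ a + δ ∧ y < b + δ then 1 else 0 : ℤ) -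
          (if x ≤ a - δ ∧ y < b + δ then 1 else 0)) -
        ((if x ≤ a + δ ∧ y < b - δ then 1 else 0) -
          (if x ≤ a - δ ∧ y < b - δ then 1 else 0))) =
      if (x, y) = (a, b) then 1 else 0 := by
  have key (u v : ℝ) : ∀ᶠ δ in 𝓝[>] (0 : ℝ), ((u ≤ v + δ ↔ u ≤ v) ∧ (u ≤ v - δ ↔ u < v)) ∧
      (u < v + δ ↔ u ≤ v) ∧ (u < v - δ ↔ u < v) := by
    have hpos : ∀ᶠ δ in 𝓝[>] (0 : ℝ), 0 < δ := self_mem_nhdsWithin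
    -- A small shift of `v` only matters for the comparison with `u` if `u = v`.
    have hsmall : ∀ᶠ δ in 𝓝[>] (0 : ℝ), u ≠ v → δ < |u - v| := by
      by_cases huv : u = v
      · simp [huv]
      · filter_upwards [nhdsWithin_le_nhds (Iio_mem_nhds (abs_pos.2 (sub_ne_zero.2 huv)))]
          with δ hδ _ using hδ
    filter_upwards [hpos, hsmall] with δ h0 hδ
    rcases lt_trichotomy u v with huv | rfl | huv
    · have := hδ huv.ne
      rw [abs_of_neg (by linarith)] at this
      refine ⟨⟨?_, ?_⟩, ?_, ?_⟩ <;> constructor <;> intro <;> linarith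
    · refine ⟨⟨?_, ?_⟩, ?_, ?_⟩ <;> constructor <;> intro <;> linarith
    · have := hδ huv.ne'
      rw [abs_of_pos (by linarith)] at this
      refine ⟨⟨?_, ?_⟩, ?_, ?_⟩ <;> constructor <;> intro <;> linarith
  filter_upwards [key x a, key y b] with δ hx hy
  simp only [hx.1.1, hx.1.2, hy.2.1, hy.2.2, Prod.mk.injEq]
  rcases lt_trichotomy x a with hxa | rfl | hxa <;> rcases lt_trichotomy y b with hyb | rfl | hyb <;>
    simp [*, le_of_lt, ne_of_lt, ne_of_gt, not_lt_of_gt, not_le_of_gt]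

/-- The diagram `Ext₀` has one point for each path component, whose coordinates are the smallest
and the largest value on the component. -/
theorem extDiagram_zero (p : ℝ × ℝ) :
    extDiagram k 0 h p = Nat.card {C : ZerothHomotopy Z // (minOn h C, maxOn h C) = p} := by
  classical
  have := Fintype.ofFinite (ZerothHomotopy Z)
  obtain ⟨a, b⟩ := p
  have key : ∀ᶠ δ in 𝓝[>] (0 : ℝ), extCount k 0 h a b δ =
      (Nat.card {C : ZerothHomotopy Z // (minOn h C, maxOn h C) = (a, b)} : ℤ) := by
    filter_upwards [Filter.eventually_all.2 fun C : ZerothHomotopy Z =>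
      eventually_quadrant_count a b (minOn h C) (maxOn h C)] with δ hδ
    rw [Nat.card_eq_fintype_card, Fintype.card_subtype, ← Finset.sum_boole, extCount]
    simp only [extBetti_zero_eq_sum, ← Finset.sum_sub_distrib]
    exact Finset.sum_congr rfl fun C _ => hδ C
  have : {m : ℕ | ∀ᶠ δ in 𝓝[>] (0 : ℝ), extCount k 0 h a b δ = m} =
      {Nat.card {C : ZerothHomotopy Z // (minOn h C, maxOn h C) = (a, b)}} := by
    ext m
    refine ⟨fun hm => ?_, ?_⟩
    · have hm : ∀ᶠ δ in 𝓝[>] (0 : ℝ), extCount k 0 h a b δ = m := hm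
      obtain ⟨δ, h1, h2⟩ := (hm.and key).exists
      exact_mod_cast h1.symm.trans h2
    · rintro rfl
      exact key
  rw [extDiagram]
  simp [this]

/-- The points of `Ext₀` are indexed by the path components. -/
lemma exists_points_equiv :
    ∃ e : ZerothHomotopy Z ≃ (extDiagram k 0 h).Points,
      ∀ C, (e C).1 = (minOn h C, maxOn h C) := by
  have e (p : ℝ × ℝ) : {C : ZerothHomotopy Z // (minOn h C, maxOn h C) = p} ≃
      Fin (extDiagram k 0 h p) :=
    (Finite.equivFin _).trans (finCongr (extDiagram_zero h k p).symm)
  exact ⟨(Equiv.sigmaFiberEquiv fun C => (minOn h C, maxOn h C)).symm.trans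
    (Equiv.sigmaCongrRight e), fun C => rfl⟩

end Extremes

/-! ### Interleavings and path components -/

section Interleaving

variable {Z W : Type u} [TopologicalSpace Z] [TopologicalSpace W] {h : C(Z, ℝ)} {h' : C(W, ℝ)}
  {ε : ℝ≥0}

/-- The map from the path components of `h⁻¹(I)` to those of the whole space. -/
def toTotal (h : C(Z, ℝ)) (I : OpenInterval) : (cosheaf h).obj I → ZerothHomotopy Z :=
  zerothHomotopyMap ⟨Subtype.val, continuous_subtype_val⟩

lemma toTotal_map {I J : OpenInterval} (i : I ⟶ J) (x : (cosheaf h).obj I) :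
    toTotal h J ((cosheaf h).map i x) = toTotal h I x := by
  change ZerothHomotopy _ at x
  induction x with
  | mk x => rfl

lemma exists_rep_of_obj (I : OpenInterval) (x : (cosheaf h).obj I) :
    ∃ z : h ⁻¹' I.toSet, x = ZerothHomotopy.mk z :=
  (ZerothHomotopy.mk_surjective x).imp fun _ => Eq.symm

/-- The open interval of radius `r` around `c`. -/
def intervalAround (c r : ℝ) (hr : 0 < r) : OpenInterval := ⟨c - r, c + r, by linarith⟩

lemma mem_intervalAround (c r : ℝ) (hr : 0 < r) : c ∈ (intervalAround c r hr).toSet :=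
  ⟨by simp [intervalAround, hr], by simp [intervalAround, hr]⟩

lemma exists_interval_of_compactSpace [CompactSpace Z] (h : C(Z, ℝ)) (I J : OpenInterval) :
    ∃ K : OpenInterval, I ≤ K ∧ J ≤ K ∧ ∀ z, h z ∈ K.toSet := by
  obtain ⟨R, hR⟩ := (isCompact_range h.continuous).isBounded.exists_norm_le
  have hR' (z : Z) : |h z| ≤ R := hR _ ⟨z, rfl⟩
  -- `|R|` instead of `R`, which may be negative if the space is empty.
  refine ⟨⟨min (min I.left J.left) (-|R| - 1), max (max I.right J.right) (|R| + 1), ?_⟩, ?_, ?_, ?_⟩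
  · simp [I.lt]
  · exact Set.Ioo_subset_Ioo (by simp) (by simp)
  · exact Set.Ioo_subset_Ioo (by simp) (by simp)
  · intro z
    have h1 := abs_le.1 ((hR' z).trans (le_abs_self R))
    exact ⟨(min_le_right _ _).trans_lt (by linarith), (lt_max_of_lt_right (by linarith))⟩

/-- A morphism from a cosheaf to a smoothed cosheaf induces a map on the path components of the
whole spaces: on intervals containing the range of `h`, the cosheaf takes the path components of
the whole space as its value. -/
lemma exists_map_zerothHomotopy [CompactSpace Z]
    (φ : cosheaf h ⟶ (smoothing ε).obj (cosheaf h')) :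
    ∃ Φ : ZerothHomotopy Z → ZerothHomotopy W, ∀ (I : OpenInterval) (x : (cosheaf h).obj I),
      toTotal h' (I.thicken ε) (φ.app I x) = Φ (toTotal h I x) := by
  have key (I J : OpenInterval) (x : (cosheaf h).obj I) (y : (cosheaf h).obj J)
      (hxy : toTotal h I x = toTotal h J y) :
      toTotal h' (I.thicken ε) (φ.app I x) = toTotal h' (J.thicken ε) (φ.app J y) := by
    obtain ⟨K, hI, hJ, hK⟩ := exists_interval_of_compactSpace h I J
    have hnat {L : OpenInterval} (i : L ⟶ K) (w : (cosheaf h).obj L) :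
        toTotal h' (L.thicken ε) (φ.app L w) =
          toTotal h' (K.thicken ε) (φ.app K ((cosheaf h).map i w)) := by
      have h1 : φ.app K ((cosheaf h).map i w) =
          (cosheaf h').map ((OpenInterval.thicken_mono ε).functor.map i) (φ.app L w) :=
        ConcreteCategory.congr_hom (φ.naturality i) w
      rw [h1]
      exact (toTotal_map _ _).symm
    rw [hnat (homOfLE hI), hnat (homOfLE hJ)]
    congr 2
    -- The inclusion of `h⁻¹(K)` into the space is a homeomorphism, hence injective on components.
    obtain ⟨x, rfl⟩ := exists_rep_of_obj I x
    obtain ⟨y, rfl⟩ := exists_rep_of_obj J y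
    exact congrArg (zerothHomotopyMap (⟨fun z => ⟨z, hK z⟩, by fun_prop⟩ : C(Z, h ⁻¹' K.toSet))) hxy
  refine ⟨ZerothHomotopy.lift (fun z => toTotal h' _ (φ.app (intervalAround (h z) 1 one_pos)
      (ZerothHomotopy.mk ⟨z, mem_intervalAround _ _ _⟩))) fun z w p =>
        key _ _ _ _ (ZerothHomotopy.sound p), fun I x => ?_⟩
  obtain ⟨x, rfl⟩ := exists_rep_of_obj I x
  exact key _ _ _ _ rfl

/-- The maps on path components induced by the two halves of an interleaving are inverse to each
other, because the inclusion of `I` in its thickening induces the identity on the components of the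
whole space. -/
lemma leftInverse_of_interleaving
    {φ : cosheaf h ⟶ (smoothing ε).obj (cosheaf h')}
    {ψ : cosheaf h' ⟶ (smoothing ε).obj (cosheaf h)}
    (hφψ : φ ≫ (smoothing ε).map ψ = toSmoothingTwice ε (cosheaf h))
    {Φ : ZerothHomotopy Z → ZerothHomotopy W} {Ψ : ZerothHomotopy W → ZerothHomotopy Z}
    (hΦ : ∀ I x, toTotal h' (I.thicken ε) (φ.app I x) = Φ (toTotal h I x))
    (hΨ : ∀ I x, toTotal h (I.thicken ε) (ψ.app I x) = Ψ (toTotal h' I x)) :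
    Function.LeftInverse Ψ Φ := by
  intro C
  obtain ⟨z, rfl⟩ := ZerothHomotopy.mk_surjective C
  let I := intervalAround (h z) 1 one_pos
  let x : (cosheaf h).obj I := ZerothHomotopy.mk ⟨z, mem_intervalAround _ _ _⟩
  change Ψ (Φ (toTotal h I x)) = toTotal h I x
  have h1 : ψ.app (I.thicken ε) (φ.app I x) = (toSmoothingTwice ε (cosheaf h)).app I x := by
    rw [← hφψ]; rfl
  calc Ψ (Φ (toTotal h I x)) = Ψ (toTotal h' (I.thicken ε) (φ.app I x)) :=
        congrArg Ψ (hΦ I x).symm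
    _ = toTotal h _ (ψ.app (I.thicken ε) (φ.app I x)) := (hΨ _ _).symm
    _ = toTotal h _ ((toSmoothingTwice ε (cosheaf h)).app I x) := congrArg _ h1
    _ = toTotal h I x := rfl

/-- The induced map sends the component of `z` to one that contains points at heights within
little more than `ε` of the height of `z`: evaluate the morphism on the interval of radius `η` around
the height of `z`. -/
lemma exists_rep_near {φ : cosheaf h ⟶ (smoothing ε).obj (cosheaf h')}
    {Φ : ZerothHomotopy Z → ZerothHomotopy W}
    (hΦ : ∀ I x, toTotal h' (I.thicken ε) (φ.app I x) = Φ (toTotal h I x)) (z : Z) {η : ℝ}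
    (hη : 0 < η) :
    ∃ w, ZerothHomotopy.mk w = Φ (.mk z) ∧ h z - η - ε < h' w ∧ h' w < h z + η + ε := by
  let I := intervalAround (h z) η hη
  obtain ⟨w, hw⟩ := exists_rep_of_obj (h := h') (I.thicken ε)
    (φ.app I (ZerothHomotopy.mk ⟨z, mem_intervalAround _ _ _⟩))
  refine ⟨w.1, ?_, w.2.1, w.2.2⟩
  have h1 := hΦ I (ZerothHomotopy.mk ⟨z, mem_intervalAround _ _ _⟩)
  rw [hw] at h1
  exact h1

variable [CompactSpace Z] [LocallyPathConnectedSpace Z] [CompactSpace W]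
  [LocallyPathConnectedSpace W]

lemma minOn_map_le {φ : cosheaf h ⟶ (smoothing ε).obj (cosheaf h')}
    {Φ : ZerothHomotopy Z → ZerothHomotopy W}
    (hΦ : ∀ I x, toTotal h' (I.thicken ε) (φ.app I x) = Φ (toTotal h I x))
    (C : ZerothHomotopy Z) : minOn h' (Φ C) ≤ minOn h C + ε := by
  obtain ⟨z, rfl, hz⟩ := exists_eq_minOn h C
  refine le_of_forall_pos_le_add fun η hη => ?_
  obtain ⟨w, hw, -, hlt⟩ := exists_rep_near hΦ z hη
  have := minOn_mk_le h' w
  rw [hw] at this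
  linarith

lemma le_maxOn_map {φ : cosheaf h ⟶ (smoothing ε).obj (cosheaf h')}
    {Φ : ZerothHomotopy Z → ZerothHomotopy W}
    (hΦ : ∀ I x, toTotal h' (I.thicken ε) (φ.app I x) = Φ (toTotal h I x))
    (C : ZerothHomotopy Z) : maxOn h C ≤ maxOn h' (Φ C) + ε := by
  obtain ⟨z, rfl, hz⟩ := exists_eq_maxOn h C
  refine le_of_forall_pos_le_add fun η hη => ?_
  obtain ⟨w, hw, hlt, -⟩ := exists_rep_near hΦ z hη
  have := le_maxOn_mk h' w
  rw [hw] at this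
  linarith

/-- An `ε`-interleaving induces a bijection between the path components of the two spaces that
changes the extreme values on components by at most `ε`. -/
theorem Interleaved.exists_equiv (H : Interleaved ε (cosheaf h) (cosheaf h')) :
    ∃ Φ : ZerothHomotopy Z ≃ ZerothHomotopy W, ∀ C,
      |minOn h C - minOn h' (Φ C)| ≤ ε ∧ |maxOn h C - maxOn h' (Φ C)| ≤ ε := by
  obtain ⟨φ, ψ, hφψ, hψφ⟩ := H
  obtain ⟨Φ, hΦ⟩ := exists_map_zerothHomotopy φ
  obtain ⟨Ψ, hΨ⟩ := exists_map_zerothHomotopy ψ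
  have hl := leftInverse_of_interleaving hφψ hΦ hΨ
  refine ⟨⟨Φ, Ψ, hl, leftInverse_of_interleaving hψφ hΨ hΦ⟩, fun C => ?_⟩
  have h1 := minOn_map_le hΦ C
  have h2 := le_maxOn_map hΦ C
  have h3 := minOn_map_le hΨ (Φ C)
  have h4 := le_maxOn_map hΨ (Φ C)
  rw [hl C] at h3 h4
  exact ⟨abs_le.2 ⟨by simp; linarith, by simp; linarith⟩,
    abs_le.2 ⟨by simp; linarith, by simp; linarith⟩⟩

end Interleaving

/-! ### Matchings -/

/-- A bijection between all points of two diagrams that moves no coordinate by more than `ε` bounds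
the bottleneck distance by `ε`. It may pair an off-diagonal point with a diagonal one; both are then
left unmatched, at a cost of at most `ε` each, since a coordinatewise `ε`-move changes
`x₁ - x₂` by at most `2 ε`. -/
lemma Diagram.bottleneckDist_le_of_equiv {D₁ D₂ : Diagram} {ε : ℝ≥0} (E : D₁.Points ≃ D₂.Points)
    (hE : ∀ x, |x.1.1 - (E x).1.1| ≤ ε ∧ |x.1.2 - (E x).1.2| ≤ ε) :
    Diagram.bottleneckDist D₁ D₂ ≤ ε := by
  classical
  -- Only pairs of two off-diagonal points may be matched.
  let S : Set D₁.Points := {x | x.1.1 ≠ x.1.2 ∧ (E x).1.1 ≠ (E x).1.2}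
  let P : D₁.Points ≃. D₂.Points := (PEquiv.ofSet S).trans E.toPEquiv
  have hP (x : D₁.Points) (y : D₂.Points) : P x = some y ↔ x ∈ S ∧ E x = y := by
    simp [P, PEquiv.trans_eq_some, PEquiv.ofSet_eq_some_iff, Equiv.toPEquiv_apply]
  have hdiag (x : D₁.Points) (hx : x ∉ S) :
      Diagram.diagCost x.1 ≤ ε ∧ Diagram.diagCost (E x).1 ≤ ε := by
    obtain ⟨h1, h2⟩ := hE x
    rw [abs_le] at h1 h2
    rw [Diagram.diagCost, Diagram.diagCost, ENNReal.ofReal_le_iff_le_toReal ENNReal.coe_ne_top,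
      ENNReal.ofReal_le_iff_le_toReal ENNReal.coe_ne_top, ENNReal.coe_toReal,
      div_le_iff₀ two_pos, div_le_iff₀ two_pos, abs_le, abs_le]
    by_cases h : x.1.1 = x.1.2
    · constructor <;> constructor <;> linarith [ε.2]
    · have h' : (E x).1.1 = (E x).1.2 := by
        by_contra h'
        exact hx ⟨h, h'⟩
      constructor <;> constructor <;> linarith [ε.2]
  let M : Diagram.Matching D₁ D₂ := ⟨P, fun x y hxy => by
    obtain ⟨hx, rfl⟩ := (hP x y).1 hxy
    exact hx⟩
  refine (iInf_le _ M).trans ?_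
  refine sup_le (sup_le (iSup_le fun x => iSup₂_le fun y hxy => ?_)
    (iSup₂_le fun x hx => ?_)) (iSup₂_le fun y hy => ?_)
  · obtain ⟨hx, rfl⟩ := (hP x y).1 hxy
    rw [edist_dist, ENNReal.ofReal_le_iff_le_toReal ENNReal.coe_ne_top, ENNReal.coe_toReal]
    exact max_le (hE x).1 (hE x).2
  · refine (hdiag x fun hxS => ?_).1
    exact Option.some_ne_none _ (((hP x (E x)).2 ⟨hxS, rfl⟩).symm.trans hx)
  · have h1 : E.symm y ∉ S := fun hyS =>
      Option.some_ne_none _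
        ((P.eq_some_iff.2 ((hP (E.symm y) y).2 ⟨hyS, by simp⟩)).symm.trans hy)
    simpa using (hdiag _ h1).2

/-! ### Stability -/

/-- Stability of `Ext₀` holds for all compact, locally path-connected domains; that the spaces are
graphs plays no role. -/
theorem extBottleneckDist_zero_le (k : Type u) [Field k] {Z W : Type u} [TopologicalSpace Z]
    [TopologicalSpace W] [CompactSpace Z] [LocallyPathConnectedSpace Z] [CompactSpace W]
    [LocallyPathConnectedSpace W] (h : C(Z, ℝ)) (h' : C(W, ℝ)) :
    extBottleneckDist k 0 h h' ≤ interleavingDist h h' := by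
  refine le_iInf₂ fun ε H => ?_
  obtain ⟨Φ, hΦ⟩ := H.exists_equiv
  obtain ⟨e, he⟩ := exists_points_equiv h k
  obtain ⟨e', he'⟩ := exists_points_equiv h' k
  refine Diagram.bottleneckDist_le_of_equiv (e.symm.trans (Φ.trans e')) fun x => ?_
  obtain ⟨C, rfl⟩ := e.surjective x
  simpa [he, he'] using hΦ C

/-! ### Topology of constructible scalar fields and their Reeb graphs -/

/-- A closed interval is a quotient of the line, by the retraction `Set.projIcc`. -/
instance locallyPathConnectedSpace_Icc (a b : ℝ) : LocallyPathConnectedSpace (Set.Icc a b) := by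
  by_cases hab : a ≤ b
  · exact (isQuotientMap_projIcc (h := hab)).locallyPathConnectedSpace
  · have : IsEmpty (Set.Icc a b) := Set.isEmpty_coe_sort.2 (Set.Icc_eq_empty hab)
    exact ⟨fun x => isEmptyElim x⟩

instance (D : ConstructibleData.{u}) : CompactSpace D.Total :=
  inferInstanceAs (CompactSpace (Quot D.Glue))

instance (D : ConstructibleData.{u}) : LocallyPathConnectedSpace D.Total :=
  inferInstanceAs (LocallyPathConnectedSpace (Quot D.Glue))

instance {X : Type u} [TopologicalSpace X] [CompactSpace X] (f : C(X, ℝ)) :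
    CompactSpace (ReebSpace f) :=
  inferInstanceAs (CompactSpace (Quotient (reebSetoid f)))

instance {X : Type u} [TopologicalSpace X] [LocallyPathConnectedSpace X] (f : C(X, ℝ)) :
    LocallyPathConnectedSpace (ReebSpace f) :=
  inferInstanceAs (LocallyPathConnectedSpace (Quotient (reebSetoid f)))

lemma IsConstructible.compactSpace {X : Type u} [TopologicalSpace X] {f : C(X, ℝ)}
    (hf : IsConstructible f) : CompactSpace X :=
  let ⟨_, e, _⟩ := hf
  e.symm.compactSpace

lemma IsConstructible.locallyPathConnectedSpace {X : Type u} [TopologicalSpace X] {f : C(X, ℝ)}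
    (hf : IsConstructible f) : LocallyPathConnectedSpace X :=
  let ⟨_, e, _⟩ := hf
  e.isOpenEmbedding.locallyPathConnectedSpace

end ReebGraph

theorem mainTheorem3 {k : Type u} [Field k] {X Y : Type u} [TopologicalSpace X]
    [TopologicalSpace Y] (f : C(X, ℝ)) (g : C(Y, ℝ))
    (hf : ReebGraph.IsConstructible f) (hg : ReebGraph.IsConstructible g) :
    ReebGraph.extBottleneckDist k 0 (ReebGraph.reebMap f) (ReebGraph.reebMap g) ≤
      ReebGraph.interleavingDist (ReebGraph.reebMap f) (ReebGraph.reebMap g) := by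
  have := hf.compactSpace
  have := hg.compactSpace
  have := hf.locallyPathConnectedSpace
  have := hg.locallyPathConnectedSpace
  exact ReebGraph.extBottleneckDist_zero_le k _ _
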